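/- Let $n\ge 2$ and $1\le i\le n-1$. For a linear subspace $H\subseteq\mathbb{R}^n$ let $R_H x=2P_Hx-x$ be the orthogonal reflection in $H$ ($P_H$ being the orthogonal projection onto $H$), and for $C\subseteq\mathbb{R}^n$ let $$M_HC=\tfrac12\,(C+R_HC)=\{\tfrac12(x+R_Hy): x,y\in C\}$$ be its Minkowski symmetral. Let $K\subset\mathbb{R}^n$ be a nonempty compact set, let $\mathcal F=\{Q_1,\dots,Q_s\}$ be a finite family of $i$-dimensional linear subspaces of $\mathbb{R}^n$, and let $(H_m)_{m\ge1}$ be a sequence of elements of $\mathcal F$. Then there is a nonempty compact convex set $L\subset\mathbb{R}^n$ such that both sequences $$K_m=M_{H_m}\cdots M_{H_1}K\qquad\text{and}\qquad \bar K_m=M_{H_m}\cdots M_{H_1}\operatorname{conv}(K)$$ converge to $L$ in the Hausdorff metric. Moreover, $R_QL=L$ for every $Q\in\mathcal F$ such that $H_m=Q$ for infinitely many $m$. -/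

import Mathlib

open Filter Topology
open scoped Pointwise

/-- The Minkowski symmetral `M_H C = (1/2) (C + R_H C)` of a set `C ⊆ ℝⁿ` with respect to a linear
subspace `H`, where `R_H x = 2 (x|H) - x` is the orthogonal reflection in `H`, and the sum and the
dilation of sets are taken pointwise. -/
noncomputable def minkowskiSymm {n : ℕ} (H : Submodule ℝ (EuclideanSpace ℝ (Fin n)))
    (C : Set (EuclideanSpace ℝ (Fin n))) : Set (EuclideanSpace ℝ (Fin n)) :=
  (1 / 2 : ℝ) • (C + H.reflection '' C)

/-- Successive Minkowski symmetrals: after `m` steps this is `M_{H (m-1)} ⋯ M_{H 1} M_{H 0} K`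
(the sequence of subspaces is indexed from `0`). -/
noncomputable def iterMinkowskiSymm {n : ℕ} (H : ℕ → Submodule ℝ (EuclideanSpace ℝ (Fin n)))
    (K : Set (EuclideanSpace ℝ (Fin n))) : ℕ → Set (EuclideanSpace ℝ (Fin n))
  | 0 => K
  | m + 1 => minkowskiSymm (H m) (iterMinkowskiSymm H K m)

/-- Convergence of a sequence of sets to `L` in the Hausdorff metric. -/
def HausdorffTendsto {n : ℕ} (A : ℕ → Set (EuclideanSpace ℝ (Fin n)))
    (L : Set (EuclideanSpace ℝ (Fin n))) : Prop :=
  Tendsto (fun m => Metric.hausdorffEDist (A m) L) atTop (𝓝 0)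

/-- `X` is `H`-symmetric: `R_H X = X`. -/
def IsSymmetricWrt {n : ℕ} (H : Submodule ℝ (EuclideanSpace ℝ (Fin n)))
    (X : Set (EuclideanSpace ℝ (Fin n))) : Prop :=
  H.reflection '' X = X

open TopologicalSpace Metric MeasureTheory

/-! Each symmetrization is nonexpansive for the Hausdorff metric and replaces the support function
`h` by the mean of `h` and `h ∘ R_H`. The integral of `h ^ 2` over the unit ball therefore never
grows, and on convex sets it stays constant only if the set is already `H`-symmetric, hence fixed.
With compactness and finitely many maps this forces convergence of convex orbits
(`exists_tendsto_of_nonexpansive_of_lyapunov`).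

For general `K`, a Shapley–Folkman type variance bound halves at each step
(`HasHullVariance.minkowskiSymm`), so the iterates approach their convex hulls, which are the
iterates of `convexHull ℝ K`. -/

/-! ### Abstract convergence of orbits -/

/-- Orbits of finitely many nonexpansive maps inside a compact set, chosen in an arbitrary order,
converge as soon as some continuous functional decreases strictly off the fixed points. -/
theorem exists_tendsto_of_nonexpansive_of_lyapunov {X ι : Type*} [MetricSpace X]
    {C : Set X} (hC : IsCompact C) (F : Finset ι) (T : ι → X → X)
    (hT : ∀ p x y, dist (T p x) (T p y) ≤ dist x y) (hTC : ∀ p, ∀ x ∈ C, T p x ∈ C)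
    {Φ : X → ℝ} (hΦ : ContinuousOn Φ C) (hle : ∀ p, ∀ x ∈ C, Φ (T p x) ≤ Φ x)
    (heq : ∀ p, ∀ x ∈ C, Φ (T p x) = Φ x → T p x = x)
    (q : ℕ → ι) (hq : ∀ m, q m ∈ F) (x : ℕ → X) (hx0 : x 0 ∈ C)
    (hx : ∀ m, x (m + 1) = T (q m) (x m)) :
    ∃ L ∈ C, Tendsto x atTop (𝓝 L) ∧ ∀ p, (∃ᶠ m in atTop, q m = p) → T p L = L := by
  have hxC : ∀ m, x m ∈ C := fun m => by
    induction m with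
    | zero => exact hx0
    | succ m ih => rw [hx]; exact hTC _ _ ih
  have hTcont : ∀ p, Continuous (T p) := fun p =>
    (LipschitzWith.of_dist_le_mul (K := 1) fun a b => by simpa using hT p a b).continuous
  have hanti : Antitone fun m => Φ (x m) :=
    antitone_nat_of_succ_le fun m => by
      change Φ (x (m + 1)) ≤ Φ (x m)
      rw [hx]
      exact hle _ _ (hxC m)
  obtain ⟨L, hL, ψ, hψ, hlim⟩ := hC.tendsto_subseq hxC
  have hΦlim : ∀ (y : ℕ → X) (M : X), M ∈ C → (∀ j, y j ∈ C) → Tendsto y atTop (𝓝 M) →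
      Tendsto (fun j => Φ (y j)) atTop (𝓝 (Φ M)) := fun y M hM hy h =>
    (hΦ M hM).tendsto.comp (tendsto_nhdsWithin_iff.2 ⟨h, Eventually.of_forall hy⟩)
  have hΦx : Tendsto (fun m => Φ (x m)) atTop (𝓝 (Φ L)) :=
    (tendsto_iff_tendsto_subseq_of_antitone hanti hψ.tendsto_atTop).2
      (hΦlim _ L hL (fun j => hxC _) hlim)
  have hdist : ∀ a b, a ≤ b → (∀ k, a ≤ k → k < b → T (q k) L = L) →
      dist (x b) L ≤ dist (x a) L := by
    intro a b hab
    induction b, hab using Nat.le_induction with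
    | base => intro _; exact le_rfl
    | succ b hab ih =>
      intro h
      refine le_trans ?_ (ih fun k hk hkb => h k hk (by omega))
      have := hT (q b) (x b) L
      rwa [h b hab (by omega), ← hx] at this
  have hfix : ∀ p, (∃ᶠ m in atTop, q m = p) → T p L = L := by
    by_contra! hcon
    obtain ⟨p₀, hp₀, hne⟩ := hcon
    have hex : ∀ j, ∃ m, ψ j ≤ m ∧ T (q m) L ≠ L := fun j => by
      obtain ⟨m, hm, rfl⟩ := frequently_atTop.1 hp₀ (ψ j)
      exact ⟨m, hm, hne⟩
    classical
    -- `μ j` is the first time from `ψ j` on at which the applied map moves `L`. All maps in between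
    -- fix `L`, so `x (μ j)` is as close to `L` as `x (ψ j)`.
    let μ : ℕ → ℕ := fun j => Nat.find (hex j)
    have hμ : ∀ j, ψ j ≤ μ j ∧ T (q (μ j)) L ≠ L := fun j => Nat.find_spec (hex j)
    have hμtop : Tendsto μ atTop atTop :=
      tendsto_atTop_mono (fun j => (hμ j).1) hψ.tendsto_atTop
    have hμlim : Tendsto (fun j => x (μ j)) atTop (𝓝 L) := by
      rw [tendsto_iff_dist_tendsto_zero] at hlim ⊢
      refine squeeze_zero (fun _ => dist_nonneg) (fun j => ?_) hlim
      refine hdist _ _ (hμ j).1 fun k hk hkm => ?_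
      by_contra h
      exact Nat.find_min (hex j) hkm ⟨hk, h⟩
    -- Pigeonhole: a single map `p` acts at infinitely many of these times. As `Φ` has the same
    -- limit before and after the step, `Φ (T p L) = Φ L`, so `p` fixes `L`, a contradiction.
    obtain ⟨p, hp⟩ : ∃ p, ∃ᶠ j in atTop, q (μ j) = p := by
      by_contra! h
      obtain ⟨j, hj⟩ := ((eventually_all_finset F).2 fun p _ => h p).exists
      exact hj _ (hq (μ j)) rfl
    obtain ⟨σ, hσ, hσp⟩ := extraction_of_frequently_atTop hp
    have hsub : Tendsto (fun k => x (μ (σ k))) atTop (𝓝 L) := hμlim.comp hσ.tendsto_atTop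
    have h1 : Tendsto (fun k => Φ (T p (x (μ (σ k))))) atTop (𝓝 (Φ (T p L))) :=
      hΦlim _ _ (hTC p L hL) (fun _ => hTC p _ (hxC _)) (((hTcont p).tendsto L).comp hsub)
    have h2 : Tendsto (fun k => Φ (T p (x (μ (σ k))))) atTop (𝓝 (Φ L)) := by
      have := hΦx.comp ((tendsto_add_atTop_nat 1).comp (hμtop.comp hσ.tendsto_atTop))
      refine this.congr fun k => ?_
      simp only [Function.comp_apply, hx, hσp]
    have := heq p L hL (tendsto_nhds_unique h1 h2)
    exact (hμ (σ 0)).2 (by rw [hσp]; exact this)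
  refine ⟨L, hL, ?_, hfix⟩
  -- Maps used only finitely often eventually disappear; after that the distance to `L` is
  -- nonincreasing, and subsequential convergence becomes convergence.
  have hev : ∀ᶠ m in atTop, T (q m) L = L := by
    have : ∀ p ∈ F, ∀ᶠ m in atTop, q m = p → T p L = L := fun p _ => by
      by_cases h : ∃ᶠ m in atTop, q m = p
      · exact Eventually.of_forall fun _ _ => hfix p h
      · exact (not_frequently.1 h).mono fun m hm hm' => absurd hm' hm
    filter_upwards [(eventually_all_finset F).2 this] with m hm using hm _ (hq m) rfl
  obtain ⟨N, hN⟩ := eventually_atTop.1 hev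
  rw [Metric.tendsto_atTop]
  intro ε hε
  obtain ⟨j, hj, hjN⟩ := ((Metric.tendsto_nhds.1 hlim ε hε).and
    (hψ.tendsto_atTop.eventually_ge_atTop N)).exists
  exact ⟨ψ j, fun m hm => (hdist _ _ hm fun k hk _ => hN k (hjN.trans hk)).trans_lt hj⟩

/-! ### Hausdorff limits of convex sets -/

theorem TopologicalSpace.NonemptyCompacts.exists_dist_le {X : Type*} [MetricSpace X]
    (K L : NonemptyCompacts X) {x : X} (hx : x ∈ K) : ∃ y ∈ L, dist x y ≤ dist K L := by
  obtain ⟨y, hy, h⟩ := L.isCompact.exists_infDist_eq_dist L.nonempty x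
  refine ⟨y, hy, ?_⟩
  rw [← h, NonemptyCompacts.dist_eq]
  exact infDist_le_hausdorffDist_of_mem hx (edist_ne_top K L)

theorem isClosed_setOf_convex_nonemptyCompacts {E : Type*} [NormedAddCommGroup E]
    [NormedSpace ℝ E] : IsClosed {K : NonemptyCompacts E | Convex ℝ (K : Set E)} := by
  refine isClosed_of_closure_subset fun L hL x hx y hy a b ha hb hab => ?_
  rw [← L.isCompact.isClosed.closure_eq, Metric.mem_closure_iff]
  intro ε hε
  obtain ⟨K, hK, hKL⟩ := Metric.mem_closure_iff.1 hL (ε / 2) (half_pos hε)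
  obtain ⟨x', hx', hxx'⟩ := L.exists_dist_le K hx
  obtain ⟨y', hy', hyy'⟩ := L.exists_dist_le K hy
  obtain ⟨z, hz, hzd⟩ := K.exists_dist_le L (hK hx' hy' ha hb hab)
  refine ⟨z, hz, ?_⟩
  rw [dist_comm K L] at hzd
  have h1 : dist (a • x + b • y) (a • x' + b • y') ≤ dist L K :=
    calc dist (a • x + b • y) (a • x' + b • y')
        ≤ dist (a • x) (a • x') + dist (b • y) (b • y') := dist_add_add_le _ _ _ _
      _ = a * dist x x' + b * dist y y' := by
        simp only [dist_smul₀, Real.norm_of_nonneg ha, Real.norm_of_nonneg hb]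
      _ ≤ a * dist L K + b * dist L K := by gcongr
      _ = dist L K := by rw [← add_mul, hab, one_mul]
  linarith [dist_triangle (a • x + b • y) (a • x' + b • y') z]

/-! ### Support functions -/

section SupportFunction

variable {E : Type*} [NormedAddCommGroup E] [InnerProductSpace ℝ E]

/-- The support function of a nonempty compact set. -/
noncomputable def supportFn (K : NonemptyCompacts E) (u : E) : ℝ :=
  sSup ((fun x => inner ℝ u x) '' (K : Set E))

theorem inner_le_supportFn (K : NonemptyCompacts E) (u : E) {x : E} (hx : x ∈ K) :
    inner ℝ u x ≤ supportFn K u :=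
  le_csSup (K.isCompact.image (by fun_prop)).bddAbove ⟨x, hx, rfl⟩

theorem supportFn_le (K : NonemptyCompacts E) (u : E) {c : ℝ}
    (h : ∀ x ∈ K, inner ℝ u x ≤ c) : supportFn K u ≤ c :=
  csSup_le (K.nonempty.image _) (by rintro _ ⟨x, hx, rfl⟩; exact h x hx)

theorem exists_inner_eq_supportFn (K : NonemptyCompacts E) (u : E) :
    ∃ x ∈ K, inner ℝ u x = supportFn K u :=
  (K.isCompact.image (by fun_prop)).sSup_mem (K.nonempty.image _)

theorem supportFn_le_add_dist (K L : NonemptyCompacts E) (u : E) :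
    supportFn K u ≤ supportFn L u + dist K L * ‖u‖ := by
  refine supportFn_le K u fun x hx => ?_
  obtain ⟨y, hy, hxy⟩ := K.exists_dist_le L hx
  have h1 : inner ℝ u x = inner ℝ u y + inner ℝ u (x - y) := by rw [inner_sub_right]; ring
  have h2 : inner ℝ u (x - y) ≤ ‖u‖ * ‖x - y‖ := real_inner_le_norm _ _
  rw [← dist_eq_norm] at h2
  nlinarith [inner_le_supportFn L u hy, norm_nonneg u]

theorem continuous_supportFn_left (u : E) : Continuous fun K => supportFn K u :=
  (LipschitzWith.of_le_add_mul ‖u‖₊ fun K L => by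
    simpa [mul_comm] using supportFn_le_add_dist K L u).continuous

theorem supportFn_le_add_norm (K : NonemptyCompacts E) {r : ℝ}
    (hr : (K : Set E) ⊆ closedBall 0 r) (u v : E) :
    supportFn K u ≤ supportFn K v + r * dist u v := by
  refine supportFn_le K u fun x hx => ?_
  have h1 : inner ℝ u x = inner ℝ v x + inner ℝ (u - v) x := by rw [inner_sub_left]; ring
  have h2 : inner ℝ (u - v) x ≤ ‖u - v‖ * ‖x‖ := real_inner_le_norm _ _
  rw [← dist_eq_norm] at h2
  have h3 : ‖x‖ ≤ r := by simpa using hr hx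
  nlinarith [inner_le_supportFn K v hx, dist_nonneg (x := u) (y := v)]

theorem continuous_supportFn (K : NonemptyCompacts E) : Continuous (supportFn K) := by
  obtain ⟨r, hr0, hr⟩ := K.isCompact.isBounded.subset_closedBall_lt 0 0
  refine (LipschitzWith.of_le_add_mul r.toNNReal fun u v => ?_).continuous
  simpa [hr0.le] using supportFn_le_add_norm K hr u v

theorem abs_supportFn_le (K : NonemptyCompacts E) {r : ℝ}
    (hr : (K : Set E) ⊆ closedBall 0 r) (u : E) : |supportFn K u| ≤ r * ‖u‖ := by
  obtain ⟨x, hx, h⟩ := exists_inner_eq_supportFn K u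
  rw [← h, mul_comm]
  exact (abs_real_inner_le_norm u x).trans
    (mul_le_mul_of_nonneg_left (by simpa using hr hx) (norm_nonneg u))

end SupportFunction

/-! ### Minkowski symmetrals -/

section Symmetral

variable {n : ℕ}

local notation "𝔼" => EuclideanSpace ℝ (Fin n)

theorem mem_minkowskiSymm {H : Submodule ℝ 𝔼} {C : Set 𝔼} {z : 𝔼} :
    z ∈ minkowskiSymm H C ↔ ∃ x ∈ C, ∃ y ∈ C, (1 / 2 : ℝ) • (x + H.reflection y) = z := by
  simp [minkowskiSymm, Set.mem_smul_set, Set.mem_add]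

theorem inner_reflection (H : Submodule ℝ 𝔼) (u x : 𝔼) :
    inner ℝ u (H.reflection x) = inner ℝ (H.reflection u) x := by
  rw [← H.reflection.inner_map_map, H.reflection_reflection]

theorem convexHull_minkowskiSymm (H : Submodule ℝ 𝔼) (C : Set 𝔼) :
    convexHull ℝ (minkowskiSymm H C) = minkowskiSymm H (convexHull ℝ C) := by
  rw [minkowskiSymm, minkowskiSymm, convexHull_smul, convexHull_add]
  congr 2
  exact (H.reflection.toLinearEquiv.toLinearMap.image_convexHull C).symm

theorem convexHull_iterMinkowskiSymm (H : ℕ → Submodule ℝ 𝔼) (K : Set 𝔼) (m : ℕ) :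
    convexHull ℝ (iterMinkowskiSymm H K m) = iterMinkowskiSymm H (convexHull ℝ K) m := by
  induction m with
  | zero => rfl
  | succ m ih => rw [iterMinkowskiSymm, convexHull_minkowskiSymm, ih, iterMinkowskiSymm]

theorem Convex.minkowskiSymm {C : Set 𝔼} (hC : Convex ℝ C) (H : Submodule ℝ 𝔼) :
    Convex ℝ (minkowskiSymm H C) := by
  rw [← hC.convexHull_eq, ← convexHull_minkowskiSymm]
  exact convex_convexHull _ _

theorem minkowskiSymm_subset_closedBall {C : Set 𝔼} {r : ℝ} (hC : C ⊆ closedBall 0 r)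
    (H : Submodule ℝ 𝔼) : minkowskiSymm H C ⊆ closedBall 0 r := by
  intro z hz
  obtain ⟨x, hx, y, hy, rfl⟩ := mem_minkowskiSymm.1 hz
  have hx' : ‖x‖ ≤ r := by simpa using hC hx
  have hy' : ‖y‖ ≤ r := by simpa using hC hy
  rw [mem_closedBall_zero_iff, norm_smul]
  have := norm_add_le x (H.reflection y)
  rw [LinearIsometryEquiv.norm_map] at this
  norm_num
  linarith

/-- The Minkowski symmetral as an operation on nonempty compact sets. -/
noncomputable def compactsSymm (H : Submodule ℝ 𝔼) (K : NonemptyCompacts 𝔼) :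
    NonemptyCompacts 𝔼 where
  carrier := minkowskiSymm H K
  isCompact' := (K.isCompact.add (K.isCompact.image H.reflection.continuous)).smul _
  nonempty' := (K.nonempty.add (K.nonempty.image _)).smul_set

/-- Successive Minkowski symmetrals of a nonempty compact set. -/
noncomputable def iterCompactsSymm (H : ℕ → Submodule ℝ 𝔼) (K : NonemptyCompacts 𝔼) :
    ℕ → NonemptyCompacts 𝔼
  | 0 => K
  | m + 1 => compactsSymm (H m) (iterCompactsSymm H K m)

theorem coe_iterCompactsSymm (H : ℕ → Submodule ℝ 𝔼) (K : NonemptyCompacts 𝔼) (m : ℕ) :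
    (iterCompactsSymm H K m : Set 𝔼) = iterMinkowskiSymm H K m := by
  induction m with
  | zero => rfl
  | succ m ih => rw [iterMinkowskiSymm, ← ih]; rfl

theorem coe_compactsSymm (H : Submodule ℝ 𝔼) (K : NonemptyCompacts 𝔼) :
    (compactsSymm H K : Set 𝔼) = minkowskiSymm H K := rfl

theorem mem_compactsSymm {H : Submodule ℝ 𝔼} {K : NonemptyCompacts 𝔼} {z : 𝔼} :
    z ∈ compactsSymm H K ↔ ∃ x ∈ K, ∃ y ∈ K, (1 / 2 : ℝ) • (x + H.reflection y) = z :=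
  mem_minkowskiSymm

/-- Both summands move by at most `ρ`, and the factor `1 / 2` averages the errors. Arbitrary sets
are allowed so that a convex hull can be compared with its closure. -/
theorem hausdorffEDist_minkowskiSymm_le (H : Submodule ℝ 𝔼) (A B : Set 𝔼) :
    hausdorffEDist (minkowskiSymm H A) (minkowskiSymm H B) ≤ hausdorffEDist A B := by
  have key : ∀ (A B : Set 𝔼) (ρ : ENNReal), hausdorffEDist A B < ρ → ∀ z ∈ minkowskiSymm H A,
      ∃ w ∈ minkowskiSymm H B, edist z w ≤ ρ := by
    intro A B ρ hρ z hz
    obtain ⟨x, hx, y, hy, rfl⟩ := mem_minkowskiSymm.1 hz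
    obtain ⟨x', hx', hxx'⟩ := exists_edist_lt_of_hausdorffEDist_lt hx hρ
    obtain ⟨y', hy', hyy'⟩ := exists_edist_lt_of_hausdorffEDist_lt hy hρ
    refine ⟨_, mem_minkowskiSymm.2 ⟨x', hx', y', hy', rfl⟩, ?_⟩
    rcases eq_or_ne ρ ⊤ with rfl | hρtop
    · exact le_top
    rw [edist_dist, ENNReal.ofReal_lt_iff_lt_toReal dist_nonneg hρtop] at hxx' hyy'
    rw [edist_dist]
    refine ENNReal.ofReal_le_of_le_toReal ?_
    have := dist_add_add_le x (H.reflection y) x' (H.reflection y')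
    rw [LinearIsometryEquiv.dist_map] at this
    rw [dist_smul₀, Real.norm_of_nonneg (by norm_num)]
    linarith
  refine le_of_forall_gt_imp_ge_of_dense fun ρ hρ => hausdorffEDist_le_of_mem_edist
    (key A B ρ hρ) (key B A ρ (by rwa [hausdorffEDist_comm]))

theorem hausdorffEDist_iterMinkowskiSymm_le (H : ℕ → Submodule ℝ 𝔼) (A B : Set 𝔼) (m : ℕ) :
    hausdorffEDist (iterMinkowskiSymm H A m) (iterMinkowskiSymm H B m) ≤ hausdorffEDist A B := by
  induction m with
  | zero => exact le_rfl
  | succ m ih => exact (hausdorffEDist_minkowskiSymm_le (H m) _ _).trans ih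

theorem dist_compactsSymm_le (H : Submodule ℝ 𝔼) (K L : NonemptyCompacts 𝔼) :
    dist (compactsSymm H K) (compactsSymm H L) ≤ dist K L :=
  ENNReal.toReal_mono (edist_ne_top K L) (hausdorffEDist_minkowskiSymm_le H K L)

theorem supportFn_compactsSymm (H : Submodule ℝ 𝔼) (K : NonemptyCompacts 𝔼) (u : 𝔼) :
    supportFn (compactsSymm H K) u = (supportFn K u + supportFn K (H.reflection u)) / 2 := by
  have key : ∀ x y : 𝔼, inner ℝ u ((1 / 2 : ℝ) • (x + H.reflection y)) =
      (inner ℝ u x + inner ℝ (H.reflection u) y) / 2 := fun x y => by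
    rw [inner_smul_right, inner_add_right, inner_reflection]; ring
  apply le_antisymm
  · refine supportFn_le _ _ fun z hz => ?_
    obtain ⟨x, hx, y, hy, rfl⟩ := mem_compactsSymm.1 hz
    rw [key]
    linarith [inner_le_supportFn K u hx, inner_le_supportFn K (H.reflection u) hy]
  · obtain ⟨x, hx, h1⟩ := exists_inner_eq_supportFn K u
    obtain ⟨y, hy, h2⟩ := exists_inner_eq_supportFn K (H.reflection u)
    rw [← h1, ← h2, ← key]
    exact inner_le_supportFn _ _ (mem_compactsSymm.2 ⟨x, hx, y, hy, rfl⟩)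

theorem isSymmetricWrt_of_supportFn_eq {H : Submodule ℝ 𝔼} {K : NonemptyCompacts 𝔼}
    (hK : Convex ℝ (K : Set 𝔼))
    (h : ∀ u ∈ ball (0 : 𝔼) 1, supportFn K u = supportFn K (H.reflection u)) :
    IsSymmetricWrt H (K : Set 𝔼) := by
  have hmem : ∀ x ∈ K, H.reflection x ∈ K := by
    intro x hx
    by_contra hx'
    obtain ⟨f, s, hfs, hs⟩ := geometric_hahn_banach_closed_point hK K.isCompact.isClosed hx'
    set v : 𝔼 := (InnerProductSpace.toDual ℝ 𝔼).symm f
    have hv : ∀ y, inner ℝ v y = f y := fun y => InnerProductSpace.toDual_symm_apply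
    have hpos : 0 < 1 + ‖v‖ := by positivity
    -- Rescaling puts the separating vector in the open unit ball, where `h` applies.
    set c : ℝ := (1 + ‖v‖)⁻¹
    have hc : 0 < c := inv_pos.2 hpos
    have hball : c • v ∈ ball (0 : 𝔼) 1 := by
      rw [mem_ball_zero_iff, norm_smul, Real.norm_of_nonneg hc.le, inv_mul_lt_one₀ hpos]
      linarith
    have h1 : supportFn K (c • v) ≤ c * s := supportFn_le _ _ fun y hy => by
      rw [real_inner_smul_left, hv]
      exact mul_le_mul_of_nonneg_left (hfs y hy).le hc.le
    have h2 := inner_le_supportFn K (H.reflection (c • v)) hx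
    rw [← h _ hball, ← inner_reflection, real_inner_smul_left, hv] at h2
    nlinarith
  refine Set.Subset.antisymm (Set.image_subset_iff.2 hmem) fun x hx => ?_
  exact ⟨H.reflection x, hmem x hx, H.reflection_reflection x⟩

theorem compactsSymm_eq_self_iff {H : Submodule ℝ 𝔼} {K : NonemptyCompacts 𝔼}
    (hK : Convex ℝ (K : Set 𝔼)) :
    compactsSymm H K = K ↔ IsSymmetricWrt H (K : Set 𝔼) := by
  constructor
  · intro h
    refine isSymmetricWrt_of_supportFn_eq hK fun u _ => ?_
    have := supportFn_compactsSymm H K u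
    rw [h] at this
    linarith
  · intro h
    refine NonemptyCompacts.ext ?_
    rw [coe_compactsSymm, minkowskiSymm, show H.reflection '' (K : Set 𝔼) = K from h, smul_add,
      ← hK.add_smul (by norm_num) (by norm_num)]
    norm_num

/-! ### The energy functional -/

/-- The integral of the squared support function over the unit ball. -/
noncomputable def supportEnergy (K : NonemptyCompacts 𝔼) : ℝ :=
  ∫ u in ball (0 : 𝔼) 1, supportFn K u ^ 2

theorem integrableOn_ball_of_continuous {f : 𝔼 → ℝ} (hf : Continuous f) :
    IntegrableOn f (ball 0 1) :=
  (hf.continuousOn.integrableOn_compact (isCompact_closedBall 0 1)).mono_set ball_subset_closedBall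

theorem setIntegral_ball_comp_reflection (H : Submodule ℝ 𝔼) (f : 𝔼 → ℝ) :
    ∫ u in ball (0 : 𝔼) 1, f (H.reflection u) = ∫ u in ball (0 : 𝔼) 1, f u := by
  have := H.reflection.measurePreserving.setIntegral_preimage_emb
    H.reflection.toHomeomorph.measurableEmbedding f (ball 0 1)
  rwa [LinearIsometryEquiv.preimage_ball, map_zero] at this

/-- Integrate `((a + b) / 2) ^ 2 = a ^ 2 / 2 + b ^ 2 / 2 - (a - b) ^ 2 / 4`; the reflection
preserves the ball and Lebesgue measure. -/
theorem supportEnergy_compactsSymm (H : Submodule ℝ 𝔼) (K : NonemptyCompacts 𝔼) :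
    supportEnergy (compactsSymm H K) = supportEnergy K -
      (1 / 4) * ∫ u in ball (0 : 𝔼) 1, (supportFn K u - supportFn K (H.reflection u)) ^ 2 := by
  have hc := continuous_supportFn K
  have hc' : Continuous fun u => supportFn K (H.reflection u) := hc.comp H.reflection.continuous
  have h1 : IntegrableOn (fun u => (1 / 2) * supportFn K u ^ 2) (ball (0 : 𝔼) 1) :=
    integrableOn_ball_of_continuous (by fun_prop)
  have h2 : IntegrableOn (fun u => (1 / 2) * supportFn K (H.reflection u) ^ 2) (ball (0 : 𝔼) 1) :=
    integrableOn_ball_of_continuous (by fun_prop)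
  have h3 : IntegrableOn (fun u => (1 / 4) * (supportFn K u - supportFn K (H.reflection u)) ^ 2)
    (ball (0 : 𝔼) 1) := integrableOn_ball_of_continuous (by fun_prop)
  have hint : ∫ u in ball (0 : 𝔼) 1, supportFn K (H.reflection u) ^ 2 = supportEnergy K :=
    setIntegral_ball_comp_reflection H fun u => supportFn K u ^ 2
  have hpt : ∀ u, supportFn (compactsSymm H K) u ^ 2 =
      (1 / 2) * supportFn K u ^ 2 + (1 / 2) * supportFn K (H.reflection u) ^ 2 -
        (1 / 4) * (supportFn K u - supportFn K (H.reflection u)) ^ 2 := fun u => by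
    rw [supportFn_compactsSymm]; ring
  rw [supportEnergy]
  simp_rw [hpt]
  have h12 : IntegrableOn (fun u => (1 / 2) * supportFn K u ^ 2 +
    (1 / 2) * supportFn K (H.reflection u) ^ 2) (ball (0 : 𝔼) 1) := h1.add h2
  rw [integral_sub h12 h3, integral_add h1 h2, integral_const_mul, integral_const_mul,
    integral_const_mul, hint, supportEnergy]
  ring

theorem supportEnergy_compactsSymm_le (H : Submodule ℝ 𝔼) (K : NonemptyCompacts 𝔼) :
    supportEnergy (compactsSymm H K) ≤ supportEnergy K := by
  rw [supportEnergy_compactsSymm]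
  have : 0 ≤ ∫ u in ball (0 : 𝔼) 1, (supportFn K u - supportFn K (H.reflection u)) ^ 2 :=
    integral_nonneg fun u => sq_nonneg _
  linarith

theorem isSymmetricWrt_of_supportEnergy_eq {H : Submodule ℝ 𝔼} {K : NonemptyCompacts 𝔼}
    (hK : Convex ℝ (K : Set 𝔼)) (h : supportEnergy (compactsSymm H K) = supportEnergy K) :
    IsSymmetricWrt H (K : Set 𝔼) := by
  rw [supportEnergy_compactsSymm] at h
  have hc := continuous_supportFn K
  have hc' : Continuous fun u => supportFn K (H.reflection u) := hc.comp H.reflection.continuous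
  have h0 : ∫ u in ball (0 : 𝔼) 1, (supportFn K u - supportFn K (H.reflection u)) ^ 2 = 0 := by
    linarith
  have hint : IntegrableOn (fun u => (supportFn K u - supportFn K (H.reflection u)) ^ 2)
    (ball (0 : 𝔼) 1) := integrableOn_ball_of_continuous ((hc.sub hc').pow 2)
  rw [integral_eq_zero_iff_of_nonneg (fun u => sq_nonneg _) hint] at h0
  refine isSymmetricWrt_of_supportFn_eq hK fun u hu => ?_
  have := Measure.eqOn_open_of_ae_eq h0 isOpen_ball ((hc.sub hc').pow 2).continuousOn
    continuousOn_const hu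
  exact sub_eq_zero.1 (pow_eq_zero_iff two_ne_zero |>.1 this)

theorem continuousOn_supportEnergy (r : ℝ) :
    ContinuousOn supportEnergy {K : NonemptyCompacts 𝔼 | (K : Set 𝔼) ⊆ closedBall 0 r} := by
  refine continuousOn_of_dominated (bound := fun _ => r ^ 2)
    (fun K _ => ((continuous_supportFn K).pow 2).aestronglyMeasurable) (fun K hK => ?_)
    (integrableOn_const measure_ball_lt_top.ne)
    (Eventually.of_forall fun u => ((continuous_supportFn_left u).pow 2).continuousOn)
  filter_upwards [ae_restrict_mem measurableSet_ball] with u hu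
  have hu' : ‖u‖ ≤ 1 := (mem_ball_zero_iff.1 hu).le
  have hr : 0 ≤ r := by
    obtain ⟨x, hx⟩ := K.nonempty
    exact (norm_nonneg x).trans (by simpa using hK hx)
  rw [Real.norm_of_nonneg (sq_nonneg _), ← sq_abs]
  exact pow_le_pow_left₀ (abs_nonneg _)
    ((abs_supportFn_le K hK u).trans (mul_le_of_le_one_right hr hu')) 2

/-! ### Distance to the convex hull -/

/-- Every point of the convex hull of `C` is, up to a variance at most `r`, an average of points
of `C`; the formulation with a free shift `v` is inherited by Minkowski symmetrals. -/
def HasHullVariance (C : Set 𝔼) (r : ℝ) : Prop :=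
  ∀ x ∈ convexHull ℝ C, ∀ v : 𝔼, ∃ z ∈ C, ‖z - x + v‖ ^ 2 ≤ ‖v‖ ^ 2 + r

theorem hasHullVariance_of_subset_closedBall {C : Set 𝔼} {r : ℝ} (hC : C ⊆ closedBall 0 r) :
    HasHullVariance C ((2 * r) ^ 2) := by
  intro x hx v
  -- Otherwise `C`, and so its hull, lies in an open half-space with `x` on its boundary. This sign
  -- removes the cross term in `‖z - x + v‖ ^ 2`.
  obtain ⟨z, hz, hzv⟩ : ∃ z ∈ C, inner ℝ (z - x) v ≤ 0 := by
    by_contra! h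
    have hsub : convexHull ℝ C ⊆ {z | inner ℝ v x < inner ℝ v z} :=
      convexHull_min (fun z hz => by
        have := h z hz
        rw [inner_sub_left, real_inner_comm v z, real_inner_comm v x] at this
        exact sub_pos.1 this)
        (convex_halfSpace_gt (innerₛₗ ℝ v).isLinear _)
    exact lt_irrefl (inner ℝ v x) (hsub hx)
  refine ⟨z, hz, ?_⟩
  have h1 : ‖z‖ ≤ r := by simpa using hC hz
  have h2 : ‖x‖ ≤ r := by simpa using convexHull_min hC (convex_closedBall 0 r) hx
  have h3 : ‖z - x‖ ^ 2 ≤ (2 * r) ^ 2 :=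
    pow_le_pow_left₀ (norm_nonneg _) ((norm_sub_le z x).trans (by linarith)) 2
  rw [norm_add_sq_real]
  linarith

theorem HasHullVariance.minkowskiSymm {C : Set 𝔼} {r : ℝ} (hC : HasHullVariance C r)
    (H : Submodule ℝ 𝔼) : HasHullVariance (minkowskiSymm H C) (r / 2) := by
  intro x hx v
  rw [convexHull_minkowskiSymm] at hx
  obtain ⟨a, ha, b, hb, rfl⟩ := mem_minkowskiSymm.1 hx
  -- The error of `y` enters the shift used to choose `z`, so the two variances add to `2 * r`; the
  -- squared factor `1 / 2` leaves `‖v‖ ^ 2 + r / 2`.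
  obtain ⟨y, hy, hyb⟩ := hC b hb (H.reflection ((2 : ℝ) • v))
  obtain ⟨z, hz, hza⟩ := hC a ha (H.reflection (y - b) + (2 : ℝ) • v)
  refine ⟨_, mem_minkowskiSymm.2 ⟨z, hz, y, hy, rfl⟩, ?_⟩
  have e1 : ‖H.reflection (y - b) + (2 : ℝ) • v‖ = ‖y - b + H.reflection ((2 : ℝ) • v)‖ := by
    rw [← H.reflection.norm_map, map_add, H.reflection_reflection]
  have e2 : (1 / 2 : ℝ) • (z + H.reflection y) - (1 / 2 : ℝ) • (a + H.reflection b) + v =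
      (1 / 2 : ℝ) • (z - a + (H.reflection (y - b) + (2 : ℝ) • v)) := by
    rw [map_sub]; module
  have e3 : ‖H.reflection ((2 : ℝ) • v)‖ = 2 * ‖v‖ := by
    rw [LinearIsometryEquiv.norm_map, norm_smul]; norm_num
  rw [e1] at hza
  rw [e3] at hyb
  rw [e2, norm_smul, mul_pow, Real.norm_of_nonneg (by norm_num)]
  linarith

theorem HasHullVariance.iterMinkowskiSymm {C : Set 𝔼} {r : ℝ} (hC : HasHullVariance C r)
    (H : ℕ → Submodule ℝ 𝔼) (m : ℕ) :
    HasHullVariance (iterMinkowskiSymm H C m) (r / 2 ^ m) := by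
  induction m with
  | zero => simpa [_root_.iterMinkowskiSymm] using hC
  | succ m ih =>
    rw [pow_succ, ← div_div]
    exact ih.minkowskiSymm (H m)

theorem HasHullVariance.hausdorffEDist_le {C : Set 𝔼} {r : ℝ} (hC : HasHullVariance C r) :
    hausdorffEDist C (convexHull ℝ C) ≤ ENNReal.ofReal (√r) := by
  refine hausdorffEDist_le_of_mem_edist
    (fun x hx => ⟨x, subset_convexHull ℝ C hx, by simp⟩) fun x hx => ?_
  obtain ⟨z, hz, h⟩ := hC x hx 0
  refine ⟨z, hz, ?_⟩
  rw [edist_dist, dist_comm, dist_eq_norm]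
  refine ENNReal.ofReal_le_ofReal (Real.le_sqrt_of_sq_le ?_)
  simpa using h

theorem tendsto_hausdorffEDist_convexHull_iterMinkowskiSymm {K : Set 𝔼} (hK : IsCompact K)
    (H : ℕ → Submodule ℝ 𝔼) :
    Tendsto (fun m => hausdorffEDist (iterMinkowskiSymm H K m)
      (iterMinkowskiSymm H (convexHull ℝ K) m)) atTop (𝓝 0) := by
  obtain ⟨r, hr⟩ := hK.isBounded.subset_closedBall 0
  have hlim : Tendsto (fun m : ℕ => ENNReal.ofReal (√((2 * r) ^ 2 / 2 ^ m))) atTop (𝓝 0) := by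
    have h : Tendsto (fun m : ℕ => (2 * r) ^ 2 / 2 ^ m) atTop (𝓝 0) :=
      tendsto_const_nhds.div_atTop (tendsto_pow_atTop_atTop_of_one_lt one_lt_two)
    simpa using ENNReal.tendsto_ofReal h.sqrt
  refine tendsto_of_tendsto_of_tendsto_of_le_of_le tendsto_const_nhds hlim
    (fun _ => zero_le) fun m => ?_
  simp only
  rw [← convexHull_iterMinkowskiSymm]
  exact ((hasHullVariance_of_subset_closedBall hr).iterMinkowskiSymm H m).hausdorffEDist_le

end Symmetral

/-! ### The main theorem -/

theorem mainTheorem2 (n i : ℕ) (hi : 1 ≤ i) (hin : i + 1 ≤ n)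
    (K : Set (EuclideanSpace ℝ (Fin n))) (hKne : K.Nonempty) (hK : IsCompact K)
    (F : Finset (Submodule ℝ (EuclideanSpace ℝ (Fin n))))
    (hF : ∀ Q ∈ F, Module.finrank ℝ Q = i)
    (H : ℕ → Submodule ℝ (EuclideanSpace ℝ (Fin n))) (hH : ∀ m, H m ∈ F) :
    ∃ L : Set (EuclideanSpace ℝ (Fin n)),
      L.Nonempty ∧ IsCompact L ∧ Convex ℝ L ∧
      HausdorffTendsto (iterMinkowskiSymm H K) L ∧
      HausdorffTendsto (iterMinkowskiSymm H (convexHull ℝ K)) L ∧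
      ∀ Q ∈ F, {m : ℕ | H m = Q}.Infinite → IsSymmetricWrt Q L := by
  obtain ⟨r, hr⟩ := hK.isBounded.subset_closedBall 0
  let K₀ : NonemptyCompacts (EuclideanSpace ℝ (Fin n)) :=
    ⟨⟨closure (convexHull ℝ K), (isBounded_convexHull.2 hK.isBounded).isCompact_closure⟩,
      hKne.convexHull.closure⟩
  obtain ⟨L, ⟨-, hLc⟩, hlim, hfix⟩ := exists_tendsto_of_nonexpansive_of_lyapunov
    ((NonemptyCompacts.isCompact_subsets_of_isCompact
      (isCompact_closedBall (0 : EuclideanSpace ℝ (Fin n)) r)).inter_right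
      isClosed_setOf_convex_nonemptyCompacts)
    F compactsSymm dist_compactsSymm_le
    (fun Q A hA => ⟨minkowskiSymm_subset_closedBall hA.1 Q, Convex.minkowskiSymm hA.2 Q⟩)
    ((continuousOn_supportEnergy r).mono Set.inter_subset_left)
    (fun Q A _ => supportEnergy_compactsSymm_le Q A)
    (fun Q A hA h => (compactsSymm_eq_self_iff hA.2).2 (isSymmetricWrt_of_supportEnergy_eq hA.2 h))
    H hH (iterCompactsSymm H K₀) 
    ⟨closure_minimal (convexHull_min hr (convex_closedBall 0 r)) isClosed_closedBall,
      (convex_convexHull ℝ K).closure⟩ (fun _ => rfl)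
  have hbar : HausdorffTendsto (iterMinkowskiSymm H (convexHull ℝ K)) L := by
    have h := tendsto_iff_edist_tendsto_0.1 hlim
    refine tendsto_of_tendsto_of_tendsto_of_le_of_le tendsto_const_nhds h
      (fun _ => zero_le) fun m => ?_
    refine (hausdorffEDist_triangle (t := iterMinkowskiSymm H (closure (convexHull ℝ K)) m)).trans ?_
    -- The closure in `K₀` costs nothing: the hull is at distance zero from it, and nonexpansiveness
    -- keeps the iterates at distance zero.
    have hz := hausdorffEDist_iterMinkowskiSymm_le H (convexHull ℝ K) (closure (convexHull ℝ K)) m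
    rw [hausdorffEDist_self_closure, nonpos_iff_eq_zero] at hz
    rw [hz, zero_add]
    exact (congrArg (hausdorffEDist · (L : Set _)) (coe_iterCompactsSymm H K₀ m)).ge
  refine ⟨L, L.nonempty, L.isCompact, hLc, ?_, hbar, fun Q _ hQ =>
    (compactsSymm_eq_self_iff hLc).1 (hfix Q (Nat.frequently_atTop_iff_infinite.2 hQ))⟩
  have hsum := (tendsto_hausdorffEDist_convexHull_iterMinkowskiSymm hK H).add hbar
  rw [add_zero] at hsum
  exact tendsto_of_tendsto_of_tendsto_of_le_of_le tendsto_const_nhds hsum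
    (fun _ => zero_le) fun m => hausdorffEDist_triangle
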